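/- Let $\varepsilon\in(0,1/4]$ be such that $1/\varepsilon$ is an integer, and put $h_B = 13/\varepsilon^2$ and $\omega=\lfloor\log_2(1/\varepsilon)\rfloor+1$. Let $I_L$ be a finite set of items (rectangles); item $i$ has width $w(i)\in[\varepsilon,1]$ and height $h(i)\in(0,1]$. Write $\mathrm{SIZE}(I_L)=\sum_{i\in I_L} w(i)h(i)$, and for any family of rectangles let $\mathrm{OPT}$ denote its minimum packing height in a strip of width $1$ (axis-parallel, without rotation, without overlap). Assume $$\mathrm{SIZE}(I_L)\ \ge\ \frac{4\omega h_B}{\varepsilon}(h_B+1),\qquad\text{and put}\qquad k=\Big\lfloor \frac{\varepsilon}{4\omega h_B}\,\mathrm{SIZE}(I_L)\Big\rfloor .$$ Let $\mathcal C$ be a finite set of containers and $\mathrm{con}\colon I_L\to\mathcal C$ a container assignment, i.e. $\sum_{i:\,\mathrm{con}(i)=c}h(i)\le h_B$ for every $c\in\mathcal C$. For a container $c$ that holds an item let $w(c)=\max\{w(i):\mathrm{con}(i)=c\}$, and let $W$ be the set of $l\in\mathbb N_0$ such that $2^{-(l+1)}<w(c)\le 2^{-l}$ for some such $c$. A group is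 a triple $(l,X,r)$ with category $l\in\mathbb N_0$, block $X\in\{A,B\}$ and position $r\in\mathbb N_0$. Let $R$ be a rounding function, mapping each container to a group. For a group $g$ let $K_g=|\{c\in\mathcal C: R(c)=g\}|$, let $I_L^g=\{i\in I_L: R(\mathrm{con}(i))=g\}$ and $h(g)=\sum_{i\in I_L^g}h(i)$. Let $q(l,X)$ be the largest $r$ with $K_{(l,X,r)}>0$ (and $0$ if there is none). Put $\mathrm{left}((l,X,r))=(l,X,r-1)$ for $r>0$ and $\mathrm{left}((l,B,0))=(l,A,q(l,A))$; nothing is to the left of $(l,A,0)$. Suppose that the following invariants hold: - (I1) $2^{-(l+1)}<w(i)\le 2^{-l}$ for every item $i$ whose group has category $l$; - (I2) $w(i)\ge w(i')$ for all $i\in I_L^g$, $i'\in I_L^{g'}$ with $g=\mathrm{left}(g')$; - (I3) for all $l\in W$: $K_{(l,A,0)}\le 2^l k$, and $K_{(l,A,r)}=2^l k$ for $1\le r\le q(l,A)$; - (I4) for all $l\in W$: $K_{(l,B,q(l,B))}\le 2^l(k-1)$, and $K_{(l,B,r)}=2^l(k-1)$ for $0\le r<q(l,B)$; - (I5) $(h_B-1)(K_g-1)\le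 h(g)\le (h_B-1)K_g$ for all groups $g$ whose category is in $W$. Let the rounded container instance $C_R$ consist of one rectangle for each container $c$ that holds at least one item, of height $h_B$ and of width $w^R(c)=\max\{w(c'): R(c')=R(c)\}$, where $c'$ ranges over the containers that hold an item. Then $$\mathrm{OPT}(C_R)\ \le\ (1+4\varepsilon)\,\mathrm{OPT}(I_L)+O(1/\varepsilon^4),$$ where the constant in the $O$-term is absolute: it does not depend on $\varepsilon$, the items, the containers, $\mathrm{con}$ or $R$. -/

import Mathlib

noncomputable section

namespace StripPacking

/-- A family of axis-parallel rectangles, indexed by `ι`. -/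
structure Rects (ι : Type*) where
  width : ι → ℝ
  height : ι → ℝ

/-- The total area of a finite family of rectangles. -/
def Rects.size {ι : Type*} [Fintype ι] (I : Rects ι) : ℝ :=
  ∑ i, I.width i * I.height i

/-- `I.Packable H`: the rectangles can be packed, without rotation and without overlap, into the
strip `[0,1] × [0,∞)` up to height `H`. Here `(x i, y i)` is the lower left corner of `i`. -/
def Rects.Packable {ι : Type*} (I : Rects ι) (H : ℝ) : Prop :=
  ∃ x y : ι → ℝ,
    (∀ i, 0 ≤ x i ∧ x i + I.width i ≤ 1 ∧ 0 ≤ y i ∧ y i + I.height i ≤ H) ∧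
    (∀ i j, i ≠ j →
      x i + I.width i ≤ x j ∨ x j + I.width j ≤ x i ∨
      y i + I.height i ≤ y j ∨ y j + I.height j ≤ y i)

/-- The optimum (strip) packing height. -/
def Rects.opt {ι : Type*} (I : Rects ι) : ℝ :=
  sInf {H : ℝ | 0 ≤ H ∧ I.Packable H}

/-- An instance of big and flat items: all widths are in `[ε, 1]`, all heights in `(0, 1]`. -/
def Rects.IsBigFlat {ι : Type*} (ε : ℝ) (I : Rects ι) : Prop :=
  ∀ i, ε ≤ I.width i ∧ I.width i ≤ 1 ∧ 0 < I.height i ∧ I.height i ≤ 1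

open Classical in
/-- `con` assigns items to containers such that the total height of the items in each container
is at most `hB`. -/
def IsContainerAssignment {ι κ : Type*} [Fintype ι] (I : Rects ι) (hB : ℝ) (con : ι → κ) : Prop :=
  ∀ c : κ, ∑ i with con i = c, I.height i ≤ hB

/-- The width of a container: the maximum width of an item in it (and `0` if there is none). -/
def containerWidth {ι κ : Type*} (I : Rects ι) (con : ι → κ) (c : κ) : ℝ :=
  ⨆ i : {i : ι // con i = c}, I.width i

/-- The two blocks of a category. -/
inductive Block
  | A
  | B

/-- A group: a category, a block, and a position in the block. -/
structure Group where
  cat : ℕ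
  block : Block
  pos : ℕ

/-- The rounded width of a container: the maximum width of a container in the same group. -/
def roundedWidth {ι κ : Type*} (I : Rects ι) (con : ι → κ) (R : κ → Group) (c : κ) : ℝ :=
  ⨆ c' : {c' : κ // R c' = R c}, containerWidth I con c'

/-- The rounded container instance: one rectangle of height `hB` and of the rounded width for
each container that holds at least one item. -/
def roundedContainerInstance {ι κ : Type*} (I : Rects ι) (hB : ℝ) (con : ι → κ) (R : κ → Group) :
    Rects {c : κ // ∃ i, con i = c} where
  width := fun c => roundedWidth I con R c
  height := fun _ => hB

/-- A width `w` belongs to category `l` if `2^{-(l+1)} < w ≤ 2^{-l}`. -/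
def InCategory (l : ℕ) (w : ℝ) : Prop :=
  ((2 : ℝ) ^ (l + 1))⁻¹ < w ∧ w ≤ ((2 : ℝ) ^ l)⁻¹

/-- The set `W` of all non-empty width categories. -/
def categories {ι κ : Type*} (I : Rects ι) (con : ι → κ) : Set ℕ :=
  {l | ∃ c : κ, InCategory l (containerWidth I con c)}

/-- `K_g`: the number of containers of group `g`. -/
def numContainers {κ : Type*} (R : κ → Group) (g : Group) : ℕ :=
  Nat.card {c : κ // R c = g}

/-- `q(l,X)`: the maximum position of a non-empty group in block `X` of category `l`
(and `0` if the block is empty). -/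
def maxPos {κ : Type*} (R : κ → Group) (l : ℕ) (X : Block) : ℕ :=
  sSup {r : ℕ | 0 < numContainers R ⟨l, X, r⟩}

/-- The group to the left of a group; the groups `(l,A,0)` have none. -/
def leftGroup {κ : Type*} (R : κ → Group) : Group → Option Group
  | ⟨l, X, r + 1⟩ => some ⟨l, X, r⟩
  | ⟨l, Block.B, 0⟩ => some ⟨l, Block.A, maxPos R l Block.A⟩
  | ⟨_, Block.A, 0⟩ => none

open Classical in
/-- `h(g)`: the total height of the items whose container belongs to group `g`. -/
def groupHeight {ι κ : Type*} [Fintype ι] (I : Rects ι) (con : ι → κ) (R : κ → Group)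
    (g : Group) : ℝ :=
  ∑ i with R (con i) = g, I.height i

/-- The invariant properties with container height `hB` and parameter `k`. -/
structure Invariants {ι κ : Type*} [Fintype ι] (I : Rects ι) (hB : ℝ) (k : ℕ)
    (con : ι → κ) (R : κ → Group) : Prop where
  /-- (I1) width categories -/
  width_categories : ∀ i, InCategory (R (con i)).cat (I.width i)
  /-- (I2) sorting of items over groups -/
  sorting : ∀ i i', leftGroup R (R (con i')) = some (R (con i)) → I.width i' ≤ I.width i
  /-- (I3) number of containers in block `A`, flexible group -/
  blockA_zero : ∀ l ∈ categories I con, (numContainers R ⟨l, Block.A, 0⟩ : ℝ) ≤ 2 ^ l * k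
  /-- (I3) number of containers in block `A`, other groups -/
  blockA : ∀ l ∈ categories I con, ∀ r, 1 ≤ r → r ≤ maxPos R l Block.A →
    (numContainers R ⟨l, Block.A, r⟩ : ℝ) = 2 ^ l * k
  /-- (I4) number of containers in block `B`, flexible group -/
  blockB_last : ∀ l ∈ categories I con,
    (numContainers R ⟨l, Block.B, maxPos R l Block.B⟩ : ℝ) ≤ 2 ^ l * ((k : ℝ) - 1)
  /-- (I4) number of containers in block `B`, other groups -/
  blockB : ∀ l ∈ categories I con, ∀ r, r < maxPos R l Block.B →
    (numContainers R ⟨l, Block.B, r⟩ : ℝ) = 2 ^ l * ((k : ℝ) - 1)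
  /-- (I5) total height of items per group -/
  height_interval : ∀ g : Group, g.cat ∈ categories I con →
    (hB - 1) * ((numContainers R g : ℝ) - 1) ≤ groupHeight I con R g ∧
    groupHeight I con R g ≤ (hB - 1) * (numContainers R g : ℝ)

end StripPacking

end

/-!
The rounded containers are compared with an arbitrary packing of the items, of height `H`.

The containers at positions `0` and `1` of the blocks are packed separately. There are at most four
such groups in each of the `ω` categories, and a group of category `l` has at most `2 ^ l * k`
containers, each of width at most `2 ^ (-l)`. They fit on `4 * ω * k` shelves of height `hB`, and
`k` is chosen such that this height is at most `ε * SIZE ≤ ε * H` (`Invariants.packable_low`).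

A group `g` at position at least `2` has a predecessor `g.prev` in the same block which is not
flexible: it has at least as many containers as `g`, and these are nearly full
(`Invariants.le_numContainers_prev` and the height invariant). By the sorting invariant, each item
of `g.prev` is at least as wide as the rounded containers of `g`. Cutting the packing by horizontal
lines gives weights on sets of items of total width at most `1`
(`Rects.Packable.exists_weights`), that is, a solution of the configuration program with total
weight `H`. Only the number of items of each predecessor group in a set matters, so by
Carathéodory's theorem (`exists_sparse_combination`) one more configuration than there are
predecessor groups suffices. Enlarging the weights by the factor `1 + ε` and rounding them up to
multiples of `hB` turns them into shelves with enough slots for all containers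
(`Invariants.packable_high`). Every predecessor group holds a large part of the total area, so that
there are `O(1 / ε ^ 2)` of them (`Invariants.card_prev_le`), and rounding costs
`O(hB / ε ^ 2) = O(1 / ε ^ 4)`.
-/

namespace StripPacking

open MeasureTheory

universe u

/-! ### Packing rectangles of equal height on shelves -/

/-- Rectangles of a common height `h` that are distributed over finitely many shelves, each of
total width at most `1`, fit into height `h` times the number of shelves. -/
theorem Rects.packable_of_shelves {α Λ : Type*} [Fintype α] [Fintype Λ] [DecidableEq Λ]
    (J : Rects α) {h : ℝ} (hh : 0 ≤ h) (hJ : ∀ a, J.height a = h) (hw : ∀ a, 0 ≤ J.width a)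
    (shelf : α → Λ) (hs : ∀ t, ∑ a with shelf a = t, J.width a ≤ 1) :
    J.Packable (Fintype.card Λ * h) := by
  classical
  let e := Fintype.equivFin α
  let d := Fintype.equivFin Λ
  have key : ∀ a b, shelf a = shelf b → e a < e b →
      (∑ c with shelf c = shelf a ∧ e c < e a, J.width c) + J.width a
        ≤ ∑ c with shelf c = shelf b ∧ e c < e b, J.width c := by
    intro a b hab hlt
    rw [add_comm, ← Finset.sum_insert (s := {c | shelf c = shelf a ∧ e c < e a}) (by simp)]
    refine Finset.sum_le_sum_of_subset_of_nonneg ?_ fun i _ _ => hw i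
    intro c
    simp only [Finset.mem_insert, Finset.mem_filter, Finset.mem_univ, true_and]
    rintro (rfl | ⟨h1, h2⟩)
    · exact ⟨hab, hlt⟩
    · exact ⟨h1.trans hab, h2.trans hlt⟩
  refine ⟨fun a => ∑ c with shelf c = shelf a ∧ e c < e a, J.width c,
    fun a => (d (shelf a) : ℕ) * h, fun a => ⟨Finset.sum_nonneg fun i _ => hw i, ?_, by positivity,
      ?_⟩, fun a b hab => ?_⟩
  · refine le_trans ?_ (hs (shelf a))
    dsimp only
    rw [add_comm, ← Finset.sum_insert (s := {c | shelf c = shelf a ∧ e c < e a}) (by simp)]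
    refine Finset.sum_le_sum_of_subset_of_nonneg ?_ fun i _ _ => hw i
    intro c
    simp only [Finset.mem_insert, Finset.mem_filter, Finset.mem_univ, true_and]
    rintro (rfl | ⟨h1, h2⟩)
    · rfl
    · exact h1
  · have : ((d (shelf a) : ℕ) : ℝ) + 1 ≤ Fintype.card Λ := by exact_mod_cast (d (shelf a)).2
    rw [hJ]
    nlinarith
  · have up : ∀ {s t : Λ}, d s < d t → ((d s : ℕ) : ℝ) * h + h ≤ (d t : ℕ) * h := by
      intro s t hst
      have : ((d s : ℕ) : ℝ) + 1 ≤ (d t : ℕ) := by exact_mod_cast hst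
      nlinarith
    rcases lt_trichotomy (d (shelf a)) (d (shelf b)) with h1 | h1 | h1
    · exact Or.inr (Or.inr (Or.inl (by rw [hJ]; exact up h1)))
    · have h1 := d.injective h1
      rcases lt_or_gt_of_ne (e.injective.ne hab) with h2 | h2
      · exact Or.inl (key a b h1 h2)
      · exact Or.inr (Or.inl (key b a h1.symm h2))
    · exact Or.inr (Or.inr (Or.inr (by rw [hJ]; exact up h1)))

/-- Shelves with prescribed slots: it suffices to place every rectangle into a slot of its own
that is wide enough. -/
theorem Rects.packable_of_slots {α Λ : Type*} {σ : Λ → Type*} [Fintype α] [Fintype Λ]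
    [∀ t, Fintype (σ t)] (J : Rects α) {h : ℝ} (hh : 0 ≤ h) (hJ : ∀ a, J.height a = h)
    (hw : ∀ a, 0 ≤ J.width a) (cap : ∀ t, σ t → ℝ) (hcap : ∀ t s, 0 ≤ cap t s)
    (hsum : ∀ t, ∑ s, cap t s ≤ 1) (f : α → Σ t, σ t) (hf : Function.Injective f)
    (hle : ∀ a, J.width a ≤ cap (f a).1 (f a).2) : J.Packable (Fintype.card Λ * h) := by
  classical
  refine J.packable_of_shelves hh hJ hw (fun a => (f a).1) fun t => le_trans ?_ (hsum t)
  calc ∑ a with (f a).1 = t, J.width a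
      ≤ ∑ a with (f a).1 = t, cap (f a).1 (f a).2 := Finset.sum_le_sum fun a _ => hle a
    _ = ∑ b ∈ (Finset.univ.filter fun a => (f a).1 = t).image f, cap b.1 b.2 :=
        (Finset.sum_image (f := fun b : Σ t, σ t => cap b.1 b.2) hf.injOn).symm
    _ ≤ ∑ b ∈ Finset.univ.image (Sigma.mk t), cap b.1 b.2 := by
        refine Finset.sum_le_sum_of_subset_of_nonneg ?_ fun b _ _ => hcap _ _
        intro b
        simp only [Finset.mem_image, Finset.mem_filter, Finset.mem_univ, true_and]
        rintro ⟨a, rfl, rfl⟩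
        exact ⟨(f a).2, rfl⟩
    _ = ∑ s, cap t s := Finset.sum_image sigma_mk_injective.injOn

/-- The subfamily of the rectangles with property `p`. -/
def Rects.restrict {α : Type*} (J : Rects α) (p : α → Prop) : Rects {a // p a} where
  width a := J.width a
  height a := J.height a

/-- A packing of the rectangles with property `p` and a packing of the others can be put on top
of each other. -/
theorem Rects.Packable.stack {α : Type*} {J : Rects α} {p : α → Prop} {H₁ H₂ : ℝ}
    (h₁ : (J.restrict p).Packable H₁) (h₂ : (J.restrict fun a => ¬ p a).Packable H₂)
    (hH₁ : 0 ≤ H₁) (hH₂ : 0 ≤ H₂) : J.Packable (H₁ + H₂) := by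
  classical
  obtain ⟨x₁, y₁, hb₁, hd₁⟩ := h₁
  obtain ⟨x₂, y₂, hb₂, hd₂⟩ := h₂
  refine ⟨fun a => if h : p a then x₁ ⟨a, h⟩ else x₂ ⟨a, h⟩,
    fun a => if h : p a then y₁ ⟨a, h⟩ else H₁ + y₂ ⟨a, h⟩, fun a => ?_, fun a b hab => ?_⟩
  · by_cases h : p a
    · obtain ⟨e1, e2, e3, e4⟩ := hb₁ ⟨a, h⟩
      simp only [restrict, h, dite_true] at *
      exact ⟨e1, e2, e3, by linarith⟩
    · obtain ⟨e1, e2, e3, e4⟩ := hb₂ ⟨a, h⟩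
      simp only [restrict, h, dite_false] at *
      exact ⟨e1, e2, by linarith, by linarith⟩
  · by_cases h : p a <;> by_cases h' : p b
    · have := hd₁ ⟨a, h⟩ ⟨b, h'⟩ (by simpa using hab)
      simpa only [restrict, h, h', dite_true] using this
    · have e1 := (hb₁ ⟨a, h⟩).2.2.2
      have e2 := (hb₂ ⟨b, h'⟩).2.2.1
      simp only [restrict, h, h', dite_true, dite_false] at *
      exact Or.inr (Or.inr (Or.inl (by linarith)))
    · have e1 := (hb₁ ⟨b, h'⟩).2.2.2
      have e2 := (hb₂ ⟨a, h⟩).2.2.1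
      simp only [restrict, h, h', dite_true, dite_false] at *
      exact Or.inr (Or.inr (Or.inr (by linarith)))
    · have := hd₂ ⟨a, h⟩ ⟨b, h'⟩ (by simpa using hab)
      simp only [restrict, h, h', dite_false] at this ⊢
      rcases this with h | h | h | h
      · exact Or.inl h
      · exact Or.inr (Or.inl h)
      · exact Or.inr (Or.inr (Or.inl (by linarith)))
      · exact Or.inr (Or.inr (Or.inr (by linarith)))

/-- An injection that respects two colourings exists as soon as every colour class of the source
is at most as large as that of the target. -/
theorem exists_injective_comp_eq {α β γ : Type*} [Finite α] [Finite β] (ψ : α → γ) (φ : β → γ)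
    (h : ∀ a, Nat.card {a' // ψ a' = ψ a} ≤ Nat.card {b // φ b = ψ a}) :
    ∃ f : α → β, Function.Injective f ∧ ∀ a, φ (f a) = ψ a := by
  classical
  have h' : ∀ g, Nat.card {a' // ψ a' = g} ≤ Nat.card {b // φ b = g} := by
    intro g
    by_cases hg : ∃ a, ψ a = g
    · obtain ⟨a, rfl⟩ := hg
      exact h a
    · have : IsEmpty {a' // ψ a' = g} := ⟨fun a => hg ⟨a.1, a.2⟩⟩
      simp
  have he : ∀ g, Nonempty ({a' // ψ a' = g} ↪ {b // φ b = g}) := fun g => by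
    have := Fintype.ofFinite {a' // ψ a' = g}
    have := Fintype.ofFinite {b // φ b = g}
    exact Function.Embedding.nonempty_of_card_le (by simpa [Nat.card_eq_fintype_card] using h' g)
  let e := fun g => (he g).some
  refine ⟨fun a => e (ψ a) ⟨a, rfl⟩, fun a b hab => ?_, fun a => (e (ψ a) ⟨a, rfl⟩).2⟩
  have hψ : ψ a = ψ b := by
    rw [← (e (ψ a) ⟨a, rfl⟩).2, ← (e (ψ b) ⟨b, rfl⟩).2]
    exact congrArg φ hab
  have gen : ∀ g g' (ha : ψ a = g) (hb : ψ b = g'), g = g' →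
      (e g ⟨a, ha⟩ : β) = e g' ⟨b, hb⟩ → a = b := by
    rintro g _ ha hb rfl hE
    exact congrArg Subtype.val ((e g).injective (Subtype.ext hE))
  exact gen _ _ rfl rfl hψ hab

/-! ### Slicing a packing by horizontal lines -/

/-- Pairwise disjoint intervals inside `[0,1]` have total length at most `1`. -/
theorem sum_length_le_one {ι : Type*} (S : Finset ι) (x w : ι → ℝ) (hw : ∀ i, 0 ≤ w i)
    (hx : ∀ i, 0 ≤ x i ∧ x i + w i ≤ 1)
    (hd : ∀ i ∈ S, ∀ j ∈ S, i ≠ j → x i + w i ≤ x j ∨ x j + w j ≤ x i) :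
    ∑ i ∈ S, w i ≤ 1 := by
  have h1 : volume (⋃ i ∈ S, Set.Ico (x i) (x i + w i)) = ∑ i ∈ S, ENNReal.ofReal (w i) := by
    rw [measure_biUnion_finset]
    · simp
    · intro i hi j hj hij
      refine Set.disjoint_left.2 fun t ht ht' => ?_
      rcases hd i hi j hj hij with h | h
      · linarith [ht.2, ht'.1]
      · linarith [ht.1, ht'.2]
    · exact fun i _ => measurableSet_Ico
  have h2 : volume (⋃ i ∈ S, Set.Ico (x i) (x i + w i)) ≤ volume (Set.Icc (0 : ℝ) 1) := by
    refine measure_mono (Set.iUnion₂_subset fun i _ t ht => ⟨?_, ?_⟩)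
    · linarith [(hx i).1, ht.1]
    · linarith [(hx i).2, ht.2]
  rw [h1, Real.volume_Icc, ← ENNReal.ofReal_sum_of_nonneg fun i _ => hw i] at h2
  simpa using (ENNReal.ofReal_le_ofReal_iff (by norm_num)).1 h2

/-- The horizontal lines through a packing of height `H` yield a fractional solution of the
configuration program: a weight `p S` for every set `S` of items (the measure of the set of
levels at which exactly the items of `S` are cut), of total weight `H`, supported on sets of
total width at most `1`, and covering every item with its height. -/
theorem Rects.Packable.exists_weights {ι : Type*} [Fintype ι] [DecidableEq ι] {I : Rects ι} {H : ℝ}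
    (hI : I.Packable H)
    (hH : 0 ≤ H) (hw : ∀ i, 0 ≤ I.width i) (hh : ∀ i, 0 ≤ I.height i) :
    ∃ p : Finset ι → ℝ, (∀ S, 0 ≤ p S) ∧ ∑ S, p S = H ∧
      (∀ i, ∑ S with i ∈ S, p S = I.height i) ∧ ∀ S, 0 < p S → ∑ i ∈ S, I.width i ≤ 1 := by
  obtain ⟨x, y, hb, hd⟩ := hI
  let cut : ℝ → Finset ι := fun t => {i | y i ≤ t ∧ t < y i + I.height i}
  have hcut : ∀ i, {t | i ∈ cut t} = Set.Ico (y i) (y i + I.height i) := by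
    intro i; ext t; simp [cut]
  have hmeas : ∀ S, MeasurableSet {t | cut t = S} := by
    intro S
    have : {t | cut t = S} = ⋂ i, {t | i ∈ cut t ↔ i ∈ S} := by
      ext t; simp [Finset.ext_iff]
    rw [this]
    refine MeasurableSet.iInter fun i => ?_
    by_cases hi : i ∈ S
    · simp [hi, hcut i]
    · have h1 : {t | i ∈ cut t ↔ i ∈ S} = (Set.Ico (y i) (y i + I.height i))ᶜ := by
        rw [← hcut i]; ext t; simp [hi]
      rw [h1]
      exact measurableSet_Ico.compl
  let A : Finset ι → Set ℝ := fun S => Set.Ico 0 H ∩ {t | cut t = S}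
  have hA : ∀ S, MeasurableSet (A S) := fun S => measurableSet_Ico.inter (hmeas S)
  have hfin : ∀ S, volume (A S) ≠ ⊤ := fun S =>
    ((measure_mono Set.inter_subset_left).trans_lt (by simp)).ne
  have hsum : ∀ T : Finset (Finset ι), ∑ S ∈ T, volume.real (A S) =
      volume.real (⋃ S ∈ T, A S) := by
    intro T
    rw [measureReal_biUnion_finset _ (fun S _ => hA S) (fun S _ => hfin S)]
    intro S _ S' _ hSS
    refine Set.disjoint_left.2 fun t ht ht' => hSS (ht.2.symm.trans ht'.2)
  refine ⟨fun S => volume.real (A S), fun S => measureReal_nonneg, ?_, fun i => ?_, fun S hS => ?_⟩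
  · rw [hsum]
    have : (⋃ S ∈ (Finset.univ : Finset (Finset ι)), A S) = Set.Ico 0 H := by
      ext t; simp [A]
    rw [this]; simp [hH]
  · rw [hsum]
    have : (⋃ S ∈ (Finset.univ.filter fun S : Finset ι => i ∈ S), A S) =
        Set.Ico (y i) (y i + I.height i) := by
      rw [← hcut]
      ext t
      simp only [A, Finset.mem_filter, Finset.mem_univ, true_and, Set.mem_iUnion, Set.mem_inter_iff,
        Set.mem_ofPred_eq, exists_prop]
      constructor
      · rintro ⟨S, hi, _, rfl⟩; exact hi
      · intro hi
        have h1 : t ∈ Set.Ico (y i) (y i + I.height i) := hcut i ▸ hi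
        exact ⟨_, hi, ⟨(hb i).2.2.1.trans h1.1, h1.2.trans_le (hb i).2.2.2⟩, rfl⟩
    rw [this]; simp [hh i]
  · obtain ⟨t, ht⟩ : (A S).Nonempty := by
      by_contra hne
      rw [Set.not_nonempty_iff_eq_empty] at hne
      simp [hne] at hS
    have hmem : ∀ i ∈ S, y i ≤ t ∧ t < y i + I.height i := by
      intro i hi
      have : i ∈ cut t := by rw [ht.2]; exact hi
      simpa [cut] using this
    refine sum_length_le_one S x I.width hw (fun i => ⟨(hb i).1, (hb i).2.1⟩) fun i hi j hj hij => ?_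
    have h1 := hmem i hi
    have h2 := hmem j hj
    rcases hd i j hij with h | h | h | h
    · exact Or.inl h
    · exact Or.inr h
    · linarith [h1.2, h2.1]
    · linarith [h1.1, h2.2]

/-- Carathéodory's theorem for conical combinations of given total weight: at most one more
vector than coordinates is needed. -/
theorem exists_sparse_combination {J : Type*} {G : Type u} [Fintype J] [Fintype G] (p : J → ℝ)
    (hp : ∀ j, 0 ≤ p j) (v : J → G → ℝ) :
    ∃ (τ : Type u) (_ : Fintype τ) (z : τ → J) (q : τ → ℝ),
      Fintype.card τ ≤ Fintype.card G + 1 ∧ (∀ a, 0 ≤ q a) ∧ (∀ a, 0 < p (z a)) ∧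
      ∑ a, q a = ∑ j, p j ∧ ∀ g, ∑ a, q a * v (z a) g = ∑ j, p j * v j g := by
  classical
  set P := ∑ j, p j with hP
  rcases (Finset.sum_nonneg fun j _ => hp j : 0 ≤ P).eq_or_lt with h0 | h0
  · have hz : ∀ j, p j = 0 := fun j =>
      (Finset.sum_eq_zero_iff_of_nonneg fun j _ => hp j).1 h0.symm j (Finset.mem_univ _)
    exact ⟨PEmpty, inferInstance, PEmpty.elim, PEmpty.elim, by simp, by simp, by simp,
      by simpa using h0, by simp [hz]⟩
  · have hP0 : P ≠ 0 := h0.ne'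
    have hmem : ∑ j with 0 < p j, (p j / P) • v j ∈ convexHull ℝ (v '' {j | 0 < p j}) := by
      refine (convex_convexHull ℝ _).sum_mem (fun j _ => div_nonneg (hp j) h0.le) ?_ fun j hj =>
        subset_convexHull ℝ _ ⟨j, by simpa using hj, rfl⟩
      rw [← Finset.sum_div, div_eq_one_iff_eq h0.ne']
      refine Finset.sum_subset (Finset.filter_subset _ _) fun j _ hj => ?_
      exact le_antisymm (by simpa using hj) (hp j)
    obtain ⟨τ, _, u, c, hu, hind, hc, hc1, hcu⟩ := eq_pos_convex_span_of_mem_convexHull hmem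
    choose z hz using fun a => hu (Set.mem_range_self a)
    refine ⟨τ, inferInstance, z, fun a => P * c a, ?_, fun a => (mul_pos h0 (hc a)).le,
      fun a => (hz a).1, by rw [← Finset.mul_sum, hc1, mul_one], fun g => ?_⟩
    · have h2 := hind.card_le_finrank_succ
      refine h2.trans (Nat.add_le_add_right ((Submodule.finrank_le _).trans ?_) 1)
      simp
    · have h3 := congrFun hcu g
      simp only [Finset.sum_apply, Pi.smul_apply, smul_eq_mul] at h3
      simp only [(hz _).2, mul_assoc]
      rw [← Finset.mul_sum, h3, Finset.mul_sum]
      rw [Finset.sum_filter]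
      refine Finset.sum_congr rfl fun j _ => ?_
      split_ifs with hj
      · rw [← mul_assoc, mul_div_cancel₀ _ hP0]
      · rw [le_antisymm (not_lt.1 hj) (hp j), zero_mul]

theorem Rects.Packable.mono {ι : Type*} {I : Rects ι} {H H' : ℝ} (h : I.Packable H)
    (hle : H ≤ H') : I.Packable H' := by
  obtain ⟨x, y, hb, hd⟩ := h
  exact ⟨x, y, fun i => ⟨(hb i).1, (hb i).2.1, (hb i).2.2.1, (hb i).2.2.2.trans hle⟩, hd⟩

theorem Rects.Packable.size_le {ι : Type*} [Fintype ι] {I : Rects ι} {H : ℝ} (hI : I.Packable H)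
    (hH : 0 ≤ H) (hw : ∀ i, 0 ≤ I.width i) (hh : ∀ i, 0 ≤ I.height i) : I.size ≤ H := by
  classical
  obtain ⟨p, hp, hpH, hpi, hp1⟩ := hI.exists_weights hH hw hh
  calc I.size = ∑ i, ∑ S : Finset ι, if i ∈ S then I.width i * p S else 0 := by
        refine Finset.sum_congr rfl fun i _ => ?_
        rw [← hpi, Finset.mul_sum, Finset.sum_filter]
    _ = ∑ S : Finset ι, p S * ∑ i ∈ S, I.width i := by
        rw [Finset.sum_comm]
        refine Finset.sum_congr rfl fun S _ => ?_
        rw [Finset.mul_sum, ← Finset.sum_filter]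
        simp [mul_comm]
    _ ≤ ∑ S, p S := by
        refine Finset.sum_le_sum fun S _ => ?_
        rcases (hp S).eq_or_lt with h | h
        · simp [← h]
        · exact mul_le_of_le_one_right h.le (hp1 S h)
    _ = H := hpH

/-- The items can always be stacked on top of each other. -/
theorem Rects.exists_packable {ι : Type*} [Fintype ι] (I : Rects ι) (hw : ∀ i, 0 ≤ I.width i ∧
    I.width i ≤ 1) (hh : ∀ i, 0 < I.height i ∧ I.height i ≤ 1) : ∃ H, 0 ≤ H ∧ I.Packable H := by
  let e := Fintype.equivFin ι
  have up : ∀ {i j : ι}, e i < e j → ((e i : ℕ) : ℝ) + I.height i ≤ (e j : ℕ) := by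
    intro i j hij
    have : ((e i : ℕ) : ℝ) + 1 ≤ (e j : ℕ) := by exact_mod_cast hij
    linarith [(hh i).2]
  refine ⟨Fintype.card ι, by positivity, fun _ => 0, fun i => (e i : ℕ),
    fun i => ⟨le_rfl, by linarith [(hw i).2], by positivity, ?_⟩, fun i j hij => ?_⟩
  · have : ((e i : ℕ) : ℝ) + 1 ≤ Fintype.card ι := by exact_mod_cast (e i).2
    linarith [(hh i).2]
  · rcases lt_or_gt_of_ne (e.injective.ne hij) with h | h
    · exact Or.inr (Or.inr (Or.inl (up h)))
    · exact Or.inr (Or.inr (Or.inr (up h)))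

/-! ### Consequences of the invariants -/

section Groups

variable {ι κ : Type*} {I : Rects ι} {con : ι → κ} {R : κ → Group}

/-- The group one position further left in the same block. -/
def Group.prev (g : Group) : Group := ⟨g.cat, g.block, g.pos - 1⟩

theorem Group.prev_injOn : Set.InjOn Group.prev {g | 2 ≤ g.pos} := by
  rintro ⟨l, X, r⟩ h ⟨l', X', r'⟩ h' heq
  simp only [prev, Group.mk.injEq, Set.mem_ofPred_eq] at *
  exact ⟨heq.1, heq.2.1, by omega⟩

theorem roundedWidth_le {b : ℝ} (hb : 0 ≤ b) {c : κ}
    (h : ∀ i, R (con i) = R c → I.width i ≤ b) : roundedWidth I con R c ≤ b :=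
  Real.iSup_le (fun c' => Real.iSup_le (fun i => h i (by rw [i.2, c'.2])) hb) hb

theorem roundedWidth_nonneg (hw : ∀ i, 0 ≤ I.width i) (c : κ) : 0 ≤ roundedWidth I con R c :=
  Real.iSup_nonneg fun _ => Real.iSup_nonneg fun _ => hw _

theorem numContainers_pos [Finite κ] (c : κ) : 0 < numContainers R (R c) :=
  have : Nonempty {c' : κ // R c' = R c} := ⟨⟨c, rfl⟩⟩
  Nat.card_pos

theorem le_maxPos [Finite κ] {l : ℕ} {X : Block} {r : ℕ} (h : 0 < numContainers R ⟨l, X, r⟩) :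
    r ≤ maxPos R l X := by
  refine le_csSup (Set.Finite.bddAbove ?_) h
  refine (Set.finite_range fun c => (R c).pos).subset fun r hr => ?_
  obtain ⟨⟨c, hc⟩⟩ := (Nat.card_pos_iff.1 hr).1
  exact ⟨c, by simp [hc]⟩

variable [Fintype ι] {hB : ℝ} {k : ℕ}

theorem Invariants.cat_mem (hI : Invariants I hB k con R) (i : ι) :
    (R (con i)).cat ∈ categories I con := by
  refine ⟨con i, (hI.width_categories i).1.trans_le ?_, Real.iSup_le (fun j => ?_) (by positivity)⟩
  · exact le_ciSup (f := fun j : {j // con j = con i} => I.width j)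
      (Set.finite_range _).bddAbove ⟨i, rfl⟩
  · have := (hI.width_categories j).2
    rwa [j.2] at this

/-- No group of a category in use has more than `2 ^ l * k` containers; so these fit on `k` shelves
of `2 ^ l` slots each. -/
theorem Invariants.numContainers_le [Finite κ] (hI : Invariants I hB k con R) {g : Group}
    (hg : g.cat ∈ categories I con) : (numContainers R g : ℝ) ≤ 2 ^ g.cat * k := by
  obtain ⟨l, X, r⟩ := g
  dsimp only at *
  rcases (numContainers R ⟨l, X, r⟩).eq_zero_or_pos with h | h
  · rw [h, Nat.cast_zero]; positivity
  have hr := le_maxPos h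
  have h2 : (2 : ℝ) ^ l * ((k : ℝ) - 1) ≤ 2 ^ l * k := by gcongr; linarith
  cases X
  · rcases r.eq_zero_or_pos with rfl | h0
    · exact hI.blockA_zero l hg
    · exact (hI.blockA l hg r h0 hr).le
  · rcases hr.eq_or_lt with rfl | h0
    · exact (hI.blockB_last l hg).trans h2
    · exact (hI.blockB l hg r h0).le.trans h2

/-- The predecessor of a nonempty group at position at least `2` is not one of the flexible
groups; so it is full, and in particular not smaller than its successor. -/
theorem Invariants.le_numContainers_prev [Finite κ] (hI : Invariants I hB k con R) {g : Group}
    (hg : g.cat ∈ categories I con) (hpos : 2 ≤ g.pos) (h : 0 < numContainers R g) :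
    numContainers R g ≤ numContainers R g.prev ∧
      2 ^ g.cat * ((k : ℝ) - 1) ≤ numContainers R g.prev := by
  obtain ⟨l, X, r⟩ := g
  have hr := le_maxPos h
  rw [← Nat.cast_le (α := ℝ)]
  simp only [Group.prev] at *
  cases X
  -- in block `A` both groups have `2 ^ l * k` containers, as the flexible position `0` is avoided
  · rw [hI.blockA l hg r (by omega) hr, hI.blockA l hg (r - 1) (by omega) (by omega)]
    refine ⟨le_rfl, ?_⟩
    gcongr
    linarith
  -- in block `B` only the last group is flexible, and it can only be smaller than the others
  · rw [hI.blockB l hg (r - 1) (by omega)]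
    refine ⟨?_, le_rfl⟩
    rcases hr.eq_or_lt with rfl | h0
    · exact hI.blockB_last l hg
    · exact (hI.blockB l hg r h0).le

theorem Invariants.width_le_of_prev (hI : Invariants I hB k con R) {i i' : ι}
    (hpos : 2 ≤ (R (con i')).pos) (h : R (con i) = (R (con i')).prev) :
    I.width i' ≤ I.width i := by
  refine hI.sorting i i' ?_
  rw [h]
  generalize R (con i') = g at hpos
  obtain ⟨l, X, r⟩ := g
  obtain ⟨r, rfl⟩ := Nat.exists_eq_add_of_le' hpos
  rfl

/-- Every predecessor group contains a substantial part of the total area, and so there are only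
few of them. -/
theorem Invariants.card_prev_le [Finite κ] [DecidableEq Group] (hI : Invariants I hB k con R)
    (hw : ∀ i, 0 ≤ I.width i) (hh : ∀ i, 0 ≤ I.height i) (hB1 : 1 ≤ hB) :
    (((Finset.univ.filter fun i => 2 ≤ (R (con i)).pos).image
      fun i => (R (con i)).prev).card : ℝ) * ((hB - 1) * (k - 2) / 2) ≤ I.size := by
  classical
  refine le_trans ?_ (Finset.sum_fiberwise_le_sum_of_sum_fiber_nonneg
    (t := (Finset.univ.filter fun i => 2 ≤ (R (con i)).pos).image fun i => (R (con i)).prev)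
    (g := fun i => R (con i)) fun g _ => Finset.sum_nonneg fun i _ => mul_nonneg (hw i) (hh i))
  rw [← nsmul_eq_mul]
  refine Finset.card_nsmul_le_sum _ _ _ fun g hg => ?_
  obtain ⟨j, hj, rfl⟩ := Finset.mem_image.1 hg
  have hj : 2 ≤ (R (con j)).pos := by simpa using hj
  have hK := (hI.le_numContainers_prev (hI.cat_mem j) hj (numContainers_pos _)).2
  have hH := (hI.height_interval (R (con j)).prev (hI.cat_mem j)).1
  set l := (R (con j)).cat
  calc (hB - 1) * ((k : ℝ) - 2) / 2
      ≤ ((2 : ℝ) ^ (l + 1))⁻¹ * ((hB - 1) * (2 ^ l * ((k : ℝ) - 1) - 1)) := by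
        rw [pow_succ]
        have h1 : (1 : ℝ) ≤ 2 ^ l := one_le_pow₀ (by norm_num)
        rw [← sub_nonneg]
        have : ((2 : ℝ) ^ l * 2)⁻¹ * ((hB - 1) * (2 ^ l * ((k : ℝ) - 1) - 1))
            - (hB - 1) * ((k : ℝ) - 2) / 2 = (hB - 1) * (2 ^ l - 1) / (2 ^ l * 2) := by
          field_simp
          ring
        rw [this]
        exact div_nonneg (mul_nonneg (by linarith) (by linarith)) (by positivity)
    _ ≤ ((2 : ℝ) ^ (l + 1))⁻¹ * groupHeight I con R (R (con j)).prev := by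
        gcongr
        exact (mul_le_mul_of_nonneg_left (by linarith) (by linarith)).trans hH
    _ ≤ _ := by
        rw [groupHeight, Finset.mul_sum]
        refine le_of_eq_of_le (Finset.sum_congr (by congr) fun _ _ => rfl)
          (Finset.sum_le_sum fun i hi => ?_)
        refine mul_le_mul_of_nonneg_right ?_ (hh i)
        have h1 := (hI.width_categories i).1.le
        rwa [(Finset.mem_filter.1 hi).2] at h1

end Groups

/-! ### Packing the rounded containers -/

section Containers

variable {ι κ : Type*} [Fintype ι] [Finite κ] {I : Rects ι} {con : ι → κ}
  {R : κ → Group} {hB : ℝ} {k : ℕ}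

theorem card_containers_le (p : κ → Prop) (q : {c // p c} → Prop) (g : Group) :
    Nat.card {c : {c : {c // p c} // q c} // R c = g} ≤ numContainers R g :=
  Nat.card_le_card_of_injective (fun c => (⟨c.1, c.2⟩ : {c : κ // R c = g})) fun c c' h => by
    simpa [Subtype.ext_iff] using h

/-- The containers at the first two positions of all blocks are put on shelves of their own:
`k` shelves with `2 ^ l` slots for every group of category `l`. -/
theorem Invariants.packable_low (hI : Invariants I hB k con R) (hB0 : 0 ≤ hB)
    (hw : ∀ i, 0 ≤ I.width i) {ω : ℕ} (hω : ∀ i, (R (con i)).cat < ω) :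
    ((roundedContainerInstance I hB con R).restrict fun c => (R c).pos ≤ 1).Packable
      (4 * ω * k * hB) := by
  classical
  have := Fintype.ofFinite {c : {c : κ // ∃ i, con i = c} // (R c).pos ≤ 1}
  let Λ := (Fin ω × Bool × Fin 2) × Fin k
  let φ : (Σ t : Λ, Fin (2 ^ (t.1.1 : ℕ))) → Group := fun b =>
    ⟨b.1.1.1, if b.1.1.2.1 then Block.A else Block.B, b.1.1.2.2⟩
  obtain ⟨f, hf, hφ⟩ := exists_injective_comp_eq
    (α := {c : {c : κ // ∃ i, con i = c} // (R c).pos ≤ 1}) (fun c => R c) φ (by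
      rintro ⟨⟨_, i, rfl⟩, hpos⟩
      refine (card_containers_le _ _ _).trans ?_
      have h1 := hI.numContainers_le (hI.cat_mem i)
      have h2 := hω i
      dsimp only at hpos h1 ⊢
      generalize R (con i) = g at *
      obtain ⟨l, X, r⟩ := g
      have h3 : numContainers R ⟨l, X, r⟩ ≤ Nat.card (Fin k × Fin (2 ^ l)) := by
        rw [Nat.card_prod, Nat.card_fin, Nat.card_fin, mul_comm]
        exact_mod_cast h1
      refine h3.trans (Nat.card_le_card_of_injective (fun s =>
        ⟨⟨((⟨l, h2⟩, decide (X = Block.A), ⟨r, Nat.lt_succ_of_le hpos⟩), s.1), s.2⟩, ?_⟩) ?_)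
      · cases X <;> simp [φ]
      · intro s s' h
        simp only [Subtype.mk.injEq, Sigma.mk.injEq] at h
        exact Prod.ext (Prod.mk.inj h.1).2 (eq_of_heq h.2))
  have hcard : (4 * ω * k * hB : ℝ) = Fintype.card Λ * hB := by
    simp only [Λ, Fintype.card_prod, Fintype.card_fin, Fintype.card_bool]
    push_cast
    ring
  rw [hcard]
  refine Rects.packable_of_slots _ hB0 (fun _ => rfl) (fun c => roundedWidth_nonneg hw _)
    (fun t _ => ((2 : ℝ) ^ (t.1.1 : ℕ))⁻¹) (fun _ _ => by positivity) (fun t => by simp) f hf ?_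
  intro c
  refine roundedWidth_le (by positivity) fun i hi => ?_
  have h1 := (hI.width_categories i).2
  rwa [hi, ← hφ c] at h1

/-- The containers at positions at least `2`: the levels of a packing of the items form a
fractional solution, which becomes sparse by Carathéodory's theorem. Every configuration used is
repeated on whole shelves, with its weight enlarged by the factor `δ` and rounded up to a multiple
of `hB`; a container takes the place of an item of the predecessor group, which is at least as
wide. -/
theorem Invariants.packable_high (hI : Invariants I hB k con R) (hB0 : 0 < hB)
    (hw : ∀ i, 0 ≤ I.width i) (hh : ∀ i, 0 ≤ I.height i) {H δ : ℝ} (hH : 0 ≤ H)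
    (hpack : I.Packable H) (hδ : 0 ≤ δ) (P : Finset Group)
    (hP : ∀ i, 2 ≤ (R (con i)).pos → (R (con i)).prev ∈ P)
    (hK : ∀ i, 2 ≤ (R (con i)).pos →
      hB * numContainers R (R (con i)) ≤ δ * groupHeight I con R (R (con i)).prev) :
    ((roundedContainerInstance I hB con R).restrict fun c => ¬ (R c).pos ≤ 1).Packable
      (δ * H + (P.card + 1) * hB) := by
  classical
  have := Fintype.ofFinite {c : {c : κ // ∃ i, con i = c} // ¬ (R c).pos ≤ 1}
  obtain ⟨p, hp, hpH, hpi, hp1⟩ := hpack.exists_weights hH hw hh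
  obtain ⟨τ, _, z, q, hτ, hq, hz, hqH, hqv⟩ := exists_sparse_combination p hp
    (fun S (g : P) => ((S.filter fun i => R (con i) = g).card : ℝ))
  have hcov : ∀ g : P, ∑ a, q a * ((z a).filter fun i => R (con i) = g).card
      = groupHeight I con R g := by
    intro g
    rw [hqv]
    calc ∑ S, p S * ((S.filter fun i => R (con i) = g).card : ℝ)
        = ∑ S : Finset ι, ∑ i with R (con i) = g, if i ∈ S then p S else 0 := by
          refine Finset.sum_congr rfl fun S _ => ?_
          rw [← Finset.sum_filter, Finset.sum_const, nsmul_eq_mul, mul_comm, Finset.filter_filter]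
          congr 3
          ext i
          simp [and_comm]
      _ = groupHeight I con R g := by
          rw [Finset.sum_comm, groupHeight]
          refine Finset.sum_congr (by congr) fun i _ => ?_
          rw [← hpi, Finset.sum_filter]
  let N : τ → ℕ := fun a => ⌈δ * q a / hB⌉₊
  let Λ := Σ a, Fin (N a)
  let φ : (Σ t : Λ, {i // i ∈ z t.1}) → Group := fun b => R (con b.2)
  obtain ⟨f, hf, hφ⟩ := exists_injective_comp_eq
    (α := {c : {c : κ // ∃ i, con i = c} // ¬ (R c).pos ≤ 1}) (fun c => (R c).prev) φ (by
      rintro ⟨⟨_, i, rfl⟩, hpos⟩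
      have hpos : 2 ≤ (R (con i)).pos := not_le.1 hpos
      dsimp only
      set g := (R (con i)).prev with hg
      calc Nat.card {c : {c : {c : κ // ∃ i, con i = c} // ¬ (R c).pos ≤ 1} // (R c).prev = g}
          ≤ Nat.card {c : {c : {c : κ // ∃ i, con i = c} // ¬ (R c).pos ≤ 1} //
              R c = R (con i)} :=
            Nat.card_le_card_of_injective (fun c => ⟨c.1, Group.prev_injOn (not_le.1 c.1.2) hpos
              c.2⟩) fun c c' h => by simpa [Subtype.ext_iff] using h
        _ ≤ numContainers R (R (con i)) := card_containers_le _ _ _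
        _ ≤ ∑ a, N a * ((z a).filter fun i => R (con i) = g).card := by
            have h1 : (numContainers R (R (con i)) : ℝ) ≤ δ / hB * groupHeight I con R g := by
              rw [div_mul_eq_mul_div, le_div_iff₀ hB0, mul_comm]
              exact hK i hpos
            rw [← Nat.cast_le (α := ℝ)]
            refine h1.trans ?_
            rw [← hcov ⟨g, hP i hpos⟩, Finset.mul_sum]
            push_cast
            refine Finset.sum_le_sum fun a _ => ?_
            rw [← mul_assoc]
            refine mul_le_mul_of_nonneg_right ?_ (Nat.cast_nonneg _)
            rw [div_mul_eq_mul_div]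
            exact Nat.le_ceil _
        _ = Nat.card (Σ a, Fin (N a) × {i // i ∈ (z a).filter fun i => R (con i) = g}) := by
            simp only [Nat.card_eq_fintype_card, Fintype.card_sigma, Fintype.card_prod,
              Fintype.card_fin, Fintype.card_coe]
        _ ≤ Nat.card {b // φ b = g} := by
            refine Nat.card_le_card_of_injective (fun s => ⟨⟨⟨s.1, s.2.1⟩,
              ⟨s.2.2, (Finset.mem_filter.1 s.2.2.2).1⟩⟩, (Finset.mem_filter.1 s.2.2.2).2⟩) ?_
            rintro ⟨a, m, i, hi⟩ ⟨a', m', i', hi'⟩ h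
            simp only [Subtype.mk.injEq, Sigma.mk.injEq] at h
            obtain ⟨⟨⟩, h3⟩ := h
            simpa using h3)
  refine (Rects.packable_of_slots (σ := fun t : Λ => {i // i ∈ z t.1}) _ hB0.le (fun _ => rfl)
    (fun c => roundedWidth_nonneg hw _) (fun t i => I.width i) (fun _ _ => hw _) (fun t => ?_) f hf
    fun c => ?_).mono ?_
  · rw [Finset.sum_coe_sort (z t.1) I.width]
    exact hp1 _ (hz _)
  · refine roundedWidth_le (hw _) fun i hi => hI.width_le_of_prev (hi ▸ not_le.1 c.2) ?_
    rw [hi]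
    exact hφ c
  · calc (Fintype.card Λ : ℝ) * hB = ∑ a, (N a : ℝ) * hB := by
          simp [Λ, Fintype.card_sigma, Finset.sum_mul]
      _ ≤ ∑ a, (δ * q a + hB) := by
          refine Finset.sum_le_sum fun a _ => ?_
          have h1 := (Nat.ceil_lt_add_one (div_nonneg (mul_nonneg hδ (hq a)) hB0.le)).le
          calc (N a : ℝ) * hB ≤ (δ * q a / hB + 1) * hB := by gcongr
            _ = δ * q a + hB := by field_simp
      _ = δ * H + Fintype.card τ * hB := by
          rw [Finset.sum_add_distrib, ← Finset.mul_sum, hqH, hpH]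
          simp
      _ ≤ δ * H + (P.card + 1) * hB := by
          have h2 : (Fintype.card τ : ℝ) ≤ P.card + 1 := by
            simpa [Fintype.card_coe] using (Nat.cast_le (α := ℝ)).2 hτ
          gcongr

end Containers

end StripPacking

theorem mainTheorem3 :
    ∃ A : ℝ, ∀ (ε : ℝ), 0 < ε → ε ≤ 1 / 4 → (∃ n : ℕ, 1 / ε = n) →
      ∀ (hB : ℝ) (ω k : ℕ) {ι κ : Type*} [Fintype ι] [Finite κ]
        (I : StripPacking.Rects ι) (con : ι → κ) (R : κ → StripPacking.Group),
        hB = 13 / ε ^ 2 →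
        ω = ⌊Real.logb 2 (1 / ε)⌋₊ + 1 →
        k = ⌊ε / (4 * ω * hB) * I.size⌋₊ →
        I.IsBigFlat ε →
        4 * ω * hB / ε * (hB + 1) ≤ I.size →
        StripPacking.IsContainerAssignment I hB con →
        StripPacking.Invariants I hB k con R →
        (StripPacking.roundedContainerInstance I hB con R).opt
          ≤ (1 + 4 * ε) * I.opt + A / ε ^ 4 := by
  classical
  -- at most `9 / ε ^ 2 + 1 ≤ 10 / ε ^ 2` configurations, each rounded up by at most `hB = 13 / ε ^ 2`
  refine ⟨130, ?_⟩
  intro ε hε hε4 ⟨n, hn⟩ hB ω k ι κ _ _ I con R hhB hω hk hflat hsize _ hI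
  have hw : ∀ i, 0 ≤ I.width i := fun i => hε.le.trans (hflat i).1
  have hh : ∀ i, 0 ≤ I.height i := fun i => (hflat i).2.2.1.le
  have hεn : ε * n = 1 := by rw [← hn]; field_simp
  have hn4 : (4 : ℝ) ≤ n := by rw [← hn, le_div_iff₀ hε]; linarith
  have hn0 : n ≠ 0 := by rintro rfl; norm_num at hn4
  have hBn : hB = 13 * n ^ 2 := by
    rw [hhB, ← hn]; field_simp
  have hB208 : 208 ≤ hB := by rw [hBn]; nlinarith
  -- `ω` is `⌊log₂ n⌋ + 1` in terms of the integer `n = 1 / ε`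
  have hωlog : ω = Nat.log 2 n + 1 := by
    rw [hω, hn]
    have := Real.natFloor_logb_natCast 2 n
    rw [Nat.cast_ofNat] at this
    rw [this]
  have hωn : (ω : ℝ) ≤ n := by
    rw [hωlog]
    exact_mod_cast Nat.log_lt_self 2 hn0
  have hω1 : (1 : ℝ) ≤ ω := by rw [hωlog]; push_cast; linarith [(Nat.log 2 n).cast_nonneg (α := ℝ)]
  have hcat : ∀ i, (R (con i)).cat < ω := by
    intro i
    have h1 := (hflat i).1.trans (hI.width_categories i).2
    rw [hωlog, Nat.lt_succ_iff]
    refine Nat.le_log_of_pow_le (by norm_num) ?_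
    rw [le_inv_comm₀ hε (by positivity), ← one_div, hn] at h1
    exact_mod_cast h1
  -- the size of `k`
  have hc : 0 < 4 * ω * hB / ε := by positivity
  have hX : ε / (4 * ω * hB) * I.size = I.size / (4 * ω * hB / ε) := by field_simp
  have hkB : hB + 1 ≤ k := by
    have h1 : ((13 * n ^ 2 + 1 : ℕ) : ℝ) = hB + 1 := by rw [hBn]; push_cast; ring
    rw [← h1, Nat.cast_le, hk]
    refine Nat.le_floor ?_
    rw [h1, hX, le_div_iff₀ hc, mul_comm]
    exact hsize
  have hsize0 : 0 ≤ I.size := Finset.sum_nonneg fun i _ => mul_nonneg (hw i) (hh i)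
  have hk1 : 4 * ω * k * hB ≤ ε * I.size := by
    have h1 : (k : ℝ) ≤ I.size / (4 * ω * hB / ε) := by
      rw [hk, hX]; exact Nat.floor_le (by positivity)
    rw [le_div_iff₀ hc] at h1
    calc 4 * ω * k * hB = ε * (k * (4 * ω * hB / ε)) := by field_simp
      _ ≤ ε * I.size := by gcongr
  have hk2 : ε * I.size ≤ 4 * ω * (k + 1) * hB := by
    have h1 : I.size / (4 * ω * hB / ε) ≤ (k + 1 : ℝ) := by
      rw [hk, hX]; exact (Nat.lt_floor_add_one _).le
    rw [div_le_iff₀ hc] at h1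
    calc ε * I.size ≤ ε * ((k + 1) * (4 * ω * hB / ε)) := by gcongr
      _ = 4 * ω * (k + 1) * hB := by field_simp
  -- there are at most `8 ω / ε` predecessor groups, up to a factor close to `1`, and `ω ≤ 1 / ε`
  have hcard := hI.card_prev_le hw hh (by linarith)
  set P := (Finset.univ.filter fun i => 2 ≤ (R (con i)).pos).image fun i => (R (con i)).prev
  have hP : (P.card : ℝ) ≤ 9 * n ^ 2 := by
    have h1 : (P.card : ℝ) * ((hB - 1) * (k - 2)) ≤ 9 * n ^ 2 * ((hB - 1) * (k - 2)) := by
      calc (P.card : ℝ) * ((hB - 1) * (k - 2))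
          = n * (2 * (ε * (P.card * ((hB - 1) * (k - 2) / 2)))) := by
            linear_combination (-(P.card : ℝ) * ((hB - 1) * (k - 2))) * hεn
        _ ≤ n * (2 * (4 * ω * (k + 1) * hB)) := by
            gcongr _ * (_ * ?_)
            exact (mul_le_mul_of_nonneg_left hcard hε.le).trans hk2
        _ ≤ n * (2 * (4 * n * (k + 1) * hB)) := by gcongr
        _ = n ^ 2 * (8 * ((k + 1) * hB)) := by ring
        _ ≤ n ^ 2 * (9 * ((hB - 1) * (k - 2))) := by
            gcongr ?_ * ?_
            nlinarith
        _ = 9 * n ^ 2 * ((hB - 1) * (k - 2)) := by ring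
    exact le_of_mul_le_mul_right h1 (mul_pos (by linarith) (by linarith))
  -- The items of the predecessor group, enlarged by `1 + ε`, cover the containers of a group: both
  -- losses `hB / (hB - 1)` and `K / (K - 1)` are close to `1`, as `K ≥ k - 1 ≥ hB ≥ 13 / ε ^ 2`.
  have hcover : ∀ i, 2 ≤ (R (con i)).pos → hB * StripPacking.numContainers R (R (con i)) ≤
      (1 + ε) * StripPacking.groupHeight I con R (R (con i)).prev := by
    intro i hpos
    obtain ⟨h1, h2⟩ := hI.le_numContainers_prev (hI.cat_mem i) hpos
      (StripPacking.numContainers_pos _)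
    have h3 := (hI.height_interval (R (con i)).prev (hI.cat_mem i)).1
    rw [← Nat.cast_le (α := ℝ)] at h1
    set K := (Nat.cast (StripPacking.numContainers R (R (con i)).prev) : ℝ)
    have hKB : hB ≤ K := by
      refine le_trans ?_ h2
      have h4 : (1 : ℝ) ≤ 2 ^ (R (con i)).cat := one_le_pow₀ (by norm_num)
      nlinarith
    have hεB : 51 ≤ ε * (hB - 1) := by
      have : ε * hB = 13 * n := by rw [hBn]; linear_combination (13 * n : ℝ) * hεn
      linarith
    calc hB * StripPacking.numContainers R (R (con i)) ≤ hB * K := by gcongr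
      _ ≤ (1 + ε) * ((hB - 1) * (K - 1)) := by nlinarith
      _ ≤ _ := by gcongr
  have hbdd : BddBelow {H : ℝ | 0 ≤ H ∧
      (StripPacking.roundedContainerInstance I hB con R).Packable H} := ⟨0, fun H hH => hH.1⟩
  have hne := I.exists_packable (fun i => ⟨hw i, (hflat i).2.1⟩) fun i => (hflat i).2.2
  have main : ∀ H, 0 ≤ H → I.Packable H →
      (StripPacking.roundedContainerInstance I hB con R).opt ≤ (1 + 4 * ε) * H + 130 / ε ^ 4 := by
    intro H hH hpack
    have hlow := hI.packable_low (by linarith) hw hcat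
    have hhigh := hI.packable_high (by linarith) hw hh hH hpack (by linarith : 0 ≤ 1 + ε) P
      (fun i hi => Finset.mem_image_of_mem _ (by simpa using hi)) hcover
    refine (csInf_le hbdd ⟨by positivity, hlow.stack hhigh (by positivity) (by positivity)⟩).trans ?_
    have h1 : 130 / ε ^ 4 = 130 * (n : ℝ) ^ 4 := by rw [← hn]; field_simp
    have h2 : ((P.card : ℝ) + 1) * hB ≤ (10 * n ^ 2) * hB := by
      gcongr
      nlinarith
    have h3 : (10 * (n : ℝ) ^ 2) * hB = 130 * (n : ℝ) ^ 4 := by rw [hBn]; ring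
    have h4 := mul_le_mul_of_nonneg_left (hpack.size_le hH hw hh) hε.le
    have h5 : 0 ≤ ε * H := by positivity
    rw [h1]
    linarith
  -- pass to the infimum over all packing heights of the items
  have h4 : 0 < 1 + 4 * ε := by linarith
  rw [← sub_le_iff_le_add, ← div_le_iff₀' h4]
  refine le_csInf hne fun H hH => ?_
  rw [div_le_iff₀' h4, sub_le_iff_le_add]
  exact main H hH.1 hH.2
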